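/- **Conventions.** For a metric space $X$, $\dim_H X$ denotes its Hausdorff dimension, with $\dim_H\emptyset=-1$. The (small inductive) topological dimension is given by $\dim_t\emptyset=-1$ and, for $X\neq\emptyset$, $$\dim_t X=\inf\{d : X \text{ has a basis } \mathcal U \text{ such that } \dim_t\partial U\le d-1 \text{ for every } U\in\mathcal U\}.$$ The $n$th inductive topological Hausdorff dimension is given by $\dim_{t^nH}\emptyset=-1$ for all $n\in\mathbb N$, $\dim_{t^0H}X=\dim_H X$ and, for $n\ge 1$ and $X\ne\emptyset$, $$\dim_{t^nH}X=\inf\{d : X\text{ has a basis }\mathcal U\text{ such that }\dim_{t^{n-1}H}\partial U\le d-1\text{ for every }U\in\mathcal U\}.$$ In both infima $d=\infty$ is admitted, all these dimensions may be $\infty$, and $\infty-k=\infty$ for $k \in \mathbb N$. For a compact metric space $K$, $C_n(K)$ is the space of continuous maps $K\to\mathbb R^n$ with the supremum norm; a property holds for the generic $f\in C_n(K)$ if the set of $f$ having it is co-meager in $C_n(K)$. **Theorem (Main Theorem).** Let $n\ge 1$ be an integer and let $K$ be a compact metric space with $\dim_t K\ge n$. Then there exists a $G_\delta$ set $G\subseteq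 K$ with $\dim_H G=\dim_{t^nH}K-n$ such that for the generic $f\in C_n(K)$: (i) $\#(f^{-1}(y)\setminus G)\le n$ for all $y\in\mathbb R^n$, and thus $\dim_H f^{-1}(y)\le\dim_{t^nH}K-n$ for all $y\in\mathbb R^n$; (ii) for every real $d<\dim_{t^nH}K$ there exists a non-empty open ball $U_{f,d}\subseteq\mathbb R^n$ such that $\dim_H f^{-1}(y)\ge d-n$ for every $y\in U_{f,d}$. -/

import Mathlib

open TopologicalSpace

universe u

/-- Hausdorff dimension of a subset of a metric space, with the convention that the empty set
has dimension `-1` (Mathlib's `dimH` gives it dimension `0`). -/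
noncomputable def hausdorffDim {X : Type u} [MetricSpace X] (s : Set X) : EReal :=
  open Classical in if s = ∅ then -1 else ((dimH s : ENNReal) : EReal)

/-- The `n`th inductive topological Hausdorff dimension of a metric space: it is `-1` for the
empty space, the Hausdorff dimension for `n = 0`, and for non-empty spaces the infimum of all `d`
such that the space has a basis whose members have boundaries (with the induced metric) of
`n`th inductive topological Hausdorff dimension at most `d - 1`, for index `n + 1`.
The value `d = ∞` is always admitted, since `⊤ - 1 = ⊤`. -/
noncomputable def indTopHausdorffDim : ℕ → (X : Type u) → [MetricSpace X] → EReal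
  | 0, X, _ => hausdorffDim (Set.univ : Set X)
  | n + 1, X, _ =>
    open Classical in
    if IsEmpty X then -1
    else sInf {d : EReal | ∃ B : Set (Set X), IsTopologicalBasis B ∧
      ∀ U ∈ B, indTopHausdorffDim n (frontier U) ≤ d - 1}

/-! Upper bound. If dim_{t^nH} K < t + n, induction over the boundaries of a countable basis gives a
set L of Hausdorff dimension at most t such that every closed set missing L is covered, at each
scale, by n closed sets that split into small clopen parts (`exists_dimH_le_fineCover`). A small
perturbation makes the i-th coordinate separate the parts of the i-th set, so by pigeonhole n + 1
points of one fibre cannot stay apart (`residual_exists_dist_lt`). When the dimension is finite, G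
is, up to one point, an intersection of G_δ hulls of such L with t tending to dim_{t^nH} K - n; its
complement lies in a countable union of closed sets missing some L.

Lower bound. If n-tuples whose common zeros have small h-content are dense, slicing by one generic
function at a time yields bases with small boundaries and bounds dim_{t^nH}
(`indTopHausdorffDim_le_of_genericallyNull`). Below the dimension this density therefore fails, by
compactness even in every closed neighbourhood of some point. A scaled copy of a bad ball of tuples
is planted there in any given map; then every nearby map has large fibres over a whole ball
(`residual_fibers_not_contentLT`). For h = 0, "large" means nonempty.

Comparing both bounds on a single generic map gives the exact dimension of G. -/

open MeasureTheory Set Metric Filter Topology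
open scoped ENNReal NNReal

/-! ### Small Hausdorff content by open covers. -/

section Content

variable {X : Type u} [MetricSpace X]

/-- `E` has a countable open cover whose `h`-dimensional size is less than `ε`. -/
def ContentLT (h : ℝ) (ε : ℝ≥0∞) (E : Set X) : Prop :=
  ∃ t : ℕ → Set X, (∀ i, IsOpen (t i)) ∧ E ⊆ ⋃ i, t i ∧
    ∑' i, ⨆ _ : (t i).Nonempty, ediam (t i) ^ h < ε

theorem ContentLT.mono {h : ℝ} {ε : ℝ≥0∞} {E F : Set X} (hF : ContentLT h ε F) (hEF : E ⊆ F) :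
    ContentLT h ε E :=
  let ⟨t, ht, hc, hs⟩ := hF
  ⟨t, ht, hEF.trans hc, hs⟩

theorem contentLT_empty (h : ℝ) {ε : ℝ≥0∞} (hε : 0 < ε) : ContentLT h ε (∅ : Set X) :=
  ⟨fun _ => ∅, fun _ => isOpen_empty, empty_subset _, by simpa using hε⟩

theorem ContentLT.exists_isOpen {h : ℝ} {ε : ℝ≥0∞} {E : Set X} (hE : ContentLT h ε E) :
    ∃ V, IsOpen V ∧ E ⊆ V ∧ ContentLT h ε V :=
  let ⟨t, ht, hc, hs⟩ := hE
  ⟨⋃ i, t i, isOpen_iUnion ht, hc, t, ht, Subset.rfl, hs⟩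

theorem ContentLT.preimage_val {h : ℝ} (hh : 0 ≤ h) {ε : ℝ≥0∞} {A E : Set X}
    (hE : ContentLT h ε E) : ContentLT h ε ((↑) ⁻¹' E : Set A) := by
  obtain ⟨t, ht, hc, hs⟩ := hE
  refine ⟨fun i => (↑) ⁻¹' (t i), fun i => (ht i).preimage continuous_subtype_val, ?_, ?_⟩
  · rw [← preimage_iUnion]
    exact preimage_mono hc
  · refine lt_of_le_of_lt (ENNReal.tsum_le_tsum fun i => iSup_le fun hne => ?_) hs
    obtain ⟨x, hx⟩ := hne
    refine le_iSup_of_le ⟨x, hx⟩ (ENNReal.rpow_le_rpow ?_ hh)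
    rw [← isometry_subtype_coe.ediam_image]
    exact ediam_mono (image_preimage_subset _ _)

/-- For exponent 0 every nonempty member of the cover contributes 1, singletons included. -/
theorem ContentLT.eq_empty {E : Set X} (hE : ContentLT 0 1 E) : E = ∅ := by
  obtain ⟨t, -, hc, hs⟩ := hE
  refine subset_empty_iff.1 (hc.trans (iUnion_subset fun i => ?_))
  by_contra hne
  rw [subset_empty_iff, ← ne_eq, ← nonempty_iff_ne_empty] at hne
  refine absurd (ENNReal.le_tsum i) (not_le.2 (hs.trans_le ?_))
  simp [hne]

variable [MeasurableSpace X] [BorelSpace X]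

/-- For h > 0, a cover of total below 1/(k+1) has all diameters at most (k+1)^(-1/h), so small
content forces small mesh. -/
theorem hausdorffMeasure_eq_zero_of_contentLT {h : ℝ} (hh : 0 ≤ h) {E : Set X}
    (hE : ∀ ε > 0, ContentLT h ε E) : μH[h] E = 0 := by
  rcases hh.eq_or_lt with rfl | hpos
  · rw [(hE 1 one_pos).eq_empty, measure_empty]
  have hε : ∀ k : ℕ, (0 : ℝ≥0∞) < ((k : ℝ≥0∞) + 1)⁻¹ := fun k => by simp
  choose t _ hc hs using fun k : ℕ => hE _ (hε k)
  have hs' : ∀ k, ∑' i, ediam (t k i) ^ h ≤ ((k : ℝ≥0∞) + 1)⁻¹ := fun k => by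
    refine le_trans (ENNReal.tsum_le_tsum fun i => ?_) (hs k).le
    rcases (t k i).eq_empty_or_nonempty with he | hne
    · simp [he, hpos]
    · simp [hne]
  have hlim : Tendsto (fun k : ℕ => ((k : ℝ≥0∞) + 1)⁻¹) atTop (𝓝 0) := by
    have := (tendsto_add_atTop_iff_nat 1).2 ENNReal.tendsto_inv_nat_nhds_zero
    simpa using this
  have hr : Tendsto (fun k : ℕ => (((k : ℝ≥0∞) + 1)⁻¹) ^ (1 / h)) atTop (𝓝 0) := by
    have := (ENNReal.continuous_rpow_const (y := 1 / h)).tendsto 0 |>.comp hlim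
    rwa [ENNReal.zero_rpow_of_pos (by positivity)] at this
  have := Measure.hausdorffMeasure_le_liminf_tsum h E _ hr t
    (Eventually.of_forall fun k i => by
      rw [one_div, ENNReal.le_rpow_inv_iff hpos]
      exact (ENNReal.le_tsum i).trans (hs' k)) (Eventually.of_forall hc)
  refine le_antisymm (this.trans ?_) zero_le
  rw [← hlim.liminf_eq]
  exact liminf_le_liminf (Eventually.of_forall hs')

theorem contentLT_of_hausdorffMeasure_eq_zero {h : ℝ} (hh : 0 ≤ h) {E : Set X}
    (hE : μH[h] E = 0) {ε : ℝ≥0∞} (hε : 0 < ε) : ContentLT h ε E := by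
  rcases hh.eq_or_lt with rfl | hpos
  · have : E = ∅ := by
      by_contra hne
      obtain ⟨x, hx⟩ := nonempty_iff_ne_empty.2 hne
      have := measure_mono_null (singleton_subset_iff.2 hx) hE
      simp [Measure.hausdorffMeasure_zero_singleton] at this
    rw [this]
    exact contentLT_empty _ hε
  rw [Measure.hausdorffMeasure_apply] at hE
  have h1 := le_antisymm ((le_iSup₂ (1 : ℝ≥0∞) one_pos).trans hE.le) zero_le
  have hε2 : (0 : ℝ≥0∞) < ε / 2 := by simp [hε.ne']
  rw [← h1] at hε2
  simp only [iInf_lt_iff] at hε2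
  obtain ⟨t, hc, hd, hs⟩ := hε2
  obtain ⟨ε', hε'0, hε'⟩ := ENNReal.exists_pos_sum_of_countable
    (ENNReal.half_pos hε.ne').ne' ℕ
  -- Each covering set is thickened to an open one, at a cost of at most `ε' i`.
  have key : ∀ i, ∃ r : ℝ≥0, 0 < r ∧
      (ediam (t i) + 2 * r) ^ h ≤ ediam (t i) ^ h + ε' i := fun i => by
    have hcont : Tendsto (fun r : ℝ≥0 => (ediam (t i) + 2 * (r : ℝ≥0∞)) ^ h) (𝓝 0)
        (𝓝 (ediam (t i) ^ h)) := by
      have : Continuous fun r : ℝ≥0 => (ediam (t i) + 2 * (r : ℝ≥0∞)) ^ h :=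
        (ENNReal.continuous_rpow_const).comp (continuous_const.add
          ((ENNReal.continuous_const_mul (by simp)).comp ENNReal.continuous_coe))
      simpa using this.tendsto 0
    have hfin : ediam (t i) ^ h ≠ ⊤ :=
      ENNReal.rpow_ne_top_of_nonneg hh (ne_top_of_le_ne_top (by simp) (hd i))
    have hlt : ediam (t i) ^ h < ediam (t i) ^ h + ε' i :=
      ENNReal.lt_add_right hfin (by simpa using (hε'0 i).ne')
    have hev := (hcont.eventually (gt_mem_nhds hlt)).filter_mono
      (nhdsWithin_le_nhds (s := Ioi 0))
    obtain ⟨r, hr1, hr2⟩ := (hev.and self_mem_nhdsWithin).exists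
    exact ⟨r, hr2, hr1.le⟩
  choose r hr0 hr using key
  refine ⟨fun i => thickening (r i) (t i), fun i => isOpen_thickening,
    hc.trans (iUnion_mono fun i => self_subset_thickening (by exact_mod_cast hr0 i) _), ?_⟩
  calc ∑' i, ⨆ _ : (thickening (r i) (t i)).Nonempty, ediam (thickening (r i : ℝ) (t i)) ^ h
      ≤ ∑' i, ((⨆ _ : (t i).Nonempty, ediam (t i) ^ h) + ε' i) := by
        refine ENNReal.tsum_le_tsum fun i => iSup_le fun hne => ?_
        have hne' : (t i).Nonempty := by
          rw [nonempty_iff_ne_empty] at hne ⊢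
          rintro he
          simp [he] at hne
        simp only [hne', iSup_pos]
        exact (ENNReal.rpow_le_rpow (ediam_thickening_le _) hh).trans (hr i)
    _ = (∑' i, ⨆ _ : (t i).Nonempty, ediam (t i) ^ h) + ∑' i, (ε' i : ℝ≥0∞) := ENNReal.tsum_add
    _ < ε / 2 + ε / 2 := ENNReal.add_lt_add hs hε'
    _ = ε := ENNReal.add_halves ε

end Content

/-! ### G_δ hulls and the passage between content and dimension. -/

section Hull

variable {X : Type u} [MetricSpace X]

theorem exists_isGδ_superset_dimH_le (E : Set X) {s : ℝ≥0} (hE : dimH E ≤ s) :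
    ∃ G, IsGδ G ∧ E ⊆ G ∧ dimH G ≤ s := by
  borelize X
  have h0 : ∀ k : ℕ, μH[((s + ((k : ℝ≥0) + 1)⁻¹ : ℝ≥0) : ℝ)] E = 0 := fun k =>
    hausdorffMeasure_of_dimH_lt (hE.trans_lt (by
      exact_mod_cast lt_add_of_pos_right s (by positivity)))
  choose V hVo hEV hV using fun k m : ℕ => (contentLT_of_hausdorffMeasure_eq_zero
    (NNReal.coe_nonneg _) (h0 k) (ε := ((m : ℝ≥0∞) + 1)⁻¹) (by simp)).exists_isOpen
  refine ⟨⋂ k, ⋂ m, V k m, .iInter fun k => .iInter fun m => (hVo k m).isGδ,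
    subset_iInter fun k => subset_iInter fun m => hEV k m, ?_⟩
  have hk : ∀ k : ℕ, dimH (⋂ k, ⋂ m, V k m) ≤ ((s + ((k : ℝ≥0) + 1)⁻¹ : ℝ≥0) : ℝ≥0∞) :=
    fun k => by
      refine dimH_le_of_hausdorffMeasure_ne_top ?_
      rw [hausdorffMeasure_eq_zero_of_contentLT (NNReal.coe_nonneg _)]
      · simp
      intro ε hε
      obtain ⟨m, hm⟩ := ENNReal.exists_inv_nat_lt hε.ne'
      obtain ⟨t, ht, hc, hs⟩ := (hV k m).mono
        ((iInter_subset (fun k => ⋂ m, V k m) k).trans (iInter_subset (V k) m))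
      exact ⟨t, ht, hc, hs.trans ((ENNReal.inv_le_inv.2 le_self_add).trans_lt hm)⟩
  refine ENNReal.le_of_forall_pos_le_add fun ε hε _ => ?_
  obtain ⟨k, hk'⟩ := exists_nat_gt (ε⁻¹)
  refine (hk k).trans ?_
  norm_cast
  gcongr
  exact inv_le_of_inv_le₀ hε (hk'.le.trans (by exact_mod_cast k.le_succ))

theorem hausdorffDim_of_nonempty {E : Set X} (hE : E.Nonempty) :
    hausdorffDim E = ((dimH E : ℝ≥0∞) : EReal) := by
  rw [hausdorffDim, if_neg hE.ne_empty]

theorem neg_one_le_hausdorffDim (E : Set X) : -1 ≤ hausdorffDim E := by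
  rw [hausdorffDim]
  split_ifs
  · exact le_rfl
  · exact le_trans (by norm_num) (EReal.coe_ennreal_nonneg _)

/-- The Hausdorff dimension bound carried by sets of vanishing `h`-dimensional measure. -/
noncomputable def nullBound (h : ℝ) : ℝ := open Classical in if h = 0 then -1 else h

theorem neg_one_le_nullBound {h : ℝ} (hh : 0 ≤ h) : -1 ≤ nullBound h := by
  rw [nullBound]
  split_ifs <;> linarith

theorem hausdorffDim_le_of_contentLT {h : ℝ} (hh : 0 ≤ h) {E : Set X}
    (hE : ∀ ε > 0, ContentLT h ε E) : hausdorffDim E ≤ ((nullBound h : ℝ) : EReal) := by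
  borelize X
  rcases E.eq_empty_or_nonempty with rfl | hne
  · rw [hausdorffDim, if_pos rfl]
    exact (EReal.coe_le_coe_iff (x := -1)).2 (neg_one_le_nullBound hh)
  rcases hh.eq_or_lt with rfl | hpos
  · exact absurd (hE 1 one_pos).eq_empty hne.ne_empty
  rw [hausdorffDim_of_nonempty hne, nullBound, if_neg hpos.ne']
  lift h to ℝ≥0 using hh
  have : dimH E ≤ h := dimH_le_of_hausdorffMeasure_ne_top (by
    rw [hausdorffMeasure_eq_zero_of_contentLT h.coe_nonneg hE]; simp)
  exact EReal.coe_ennreal_le_coe_ennreal_iff.2 this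

theorem le_hausdorffDim_of_not_contentLT {h : ℝ} (hh : 0 ≤ h) {E : Set X} {ε : ℝ≥0∞} (hε : 0 < ε)
    (hE : ¬ ContentLT h ε E) : (h : EReal) ≤ hausdorffDim E := by
  borelize X
  have hne : E.Nonempty := by
    rw [nonempty_iff_ne_empty]
    rintro rfl
    exact hE (contentLT_empty h hε)
  rw [hausdorffDim_of_nonempty hne]
  lift h to ℝ≥0 using hh
  have : (h : ℝ≥0∞) ≤ dimH E := le_dimH_of_hausdorffMeasure_ne_zero fun h0 =>
    hE (contentLT_of_hausdorffMeasure_eq_zero h.coe_nonneg h0 hε)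
  exact EReal.coe_ennreal_le_coe_ennreal_iff.2 this

end Hull

/-! ### Common zeros of generic tuples of functions. -/

section GenericZeros

variable {X : Type u} [MetricSpace X]

/-- The set of common zeros of finitely many continuous functions. -/
def commonZeros {n : ℕ} (g : Fin n → C(X, ℝ)) : Set X := {x | ∀ i, g i x = 0}

/-- Arbitrarily small perturbations of any `n` functions have common zeros in `A` of arbitrarily
small `h`-dimensional content. -/
def GenericallyNull (h : ℝ) (n : ℕ) (A : Set X) : Prop :=
  ∀ ε > 0, Dense {g : Fin n → C(X, ℝ) | ContentLT h ε (A ∩ commonZeros g)}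

theorem GenericallyNull.mono {h : ℝ} {n : ℕ} {A B : Set X} (hB : GenericallyNull h n B)
    (hAB : A ⊆ B) : GenericallyNull h n A := fun ε hε =>
  (hB ε hε).mono fun _ hg => ContentLT.mono hg (inter_subset_inter_left _ hAB)

theorem ContentLT.mono_right {h : ℝ} {ε ε' : ℝ≥0∞} {E : Set X} (hE : ContentLT h ε E)
    (hεε' : ε ≤ ε') : ContentLT h ε' E :=
  let ⟨t, ht, hc, hs⟩ := hE
  ⟨t, ht, hc, hs.trans_le hεε'⟩

theorem exists_nat_inv_succ_lt {ε : ℝ≥0∞} (hε : 0 < ε) : ∃ m : ℕ, ((m : ℝ≥0∞) + 1)⁻¹ < ε := by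
  obtain ⟨m, hm⟩ := ENNReal.exists_inv_nat_lt hε.ne'
  exact ⟨m, (ENNReal.inv_le_inv.2 le_self_add).trans_lt hm⟩

theorem GenericallyNull.subtype {h : ℝ} (hh : 0 ≤ h) {n : ℕ} {A : Set X} (hA : IsClosed A) (hAn : GenericallyNull h n A) :
    GenericallyNull h n (univ : Set A) := fun ε hε => by
  let R : (Fin n → C(X, ℝ)) → (Fin n → C(A, ℝ)) := fun g i => (g i).restrict A
  have hRc : Continuous R := continuous_pi fun i =>
    (ContinuousMap.continuous_restrict A).comp (continuous_apply i)
  have hRs : Function.Surjective R := fun g => by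
    -- Tietze extension: restriction is onto, so it carries dense sets to dense sets.
    choose g' hg' using fun i => ContinuousMap.exists_restrict_eq hA (g i)
    exact ⟨g', funext hg'⟩
  refine (hRs.denseRange.dense_image hRc (hAn ε hε)).mono ?_
  rintro _ ⟨g, hg, rfl⟩
  exact (ContentLT.preimage_val hh hg).mono fun x hx => ⟨x.2, hx.2⟩

variable [CompactSpace X]

theorem isOpen_contentLT_commonZeros {h : ℝ} {n : ℕ} {ε : ℝ≥0∞} {A : Set X} (hA : IsClosed A) :
    IsOpen {g : Fin n → C(X, ℝ) | ContentLT h ε (A ∩ commonZeros g)} := by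
  refine isOpen_iff_mem_nhds.2 fun g hg => ?_
  obtain ⟨V, hVo, hgV, hV⟩ := ContentLT.exists_isOpen hg
  have hcl : IsClosed {p : (Fin n → C(X, ℝ)) × X | p.2 ∈ A \ V ∧ ∀ i, p.1 i p.2 = 0} := by
    simp only [ofPred_and, ofPred_forall]
    refine ((hA.sdiff hVo).preimage continuous_snd).inter
      (isClosed_iInter fun i => isClosed_eq ?_ continuous_const)
    exact ((continuous_apply i).comp continuous_fst).eval continuous_snd
  -- The tuples with a zero in A outside V form the projection of a closed set along the compact
  -- space.
  have hcl' := isClosedMap_fst_of_compactSpace _ hcl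
  refine mem_of_superset (hcl'.isOpen_compl.mem_nhds ?_) fun g' hg' => hV.mono fun x hx => ?_
  · rintro ⟨⟨g', x⟩, ⟨hx, hz⟩, rfl⟩
    exact hx.2 (hgV ⟨hx.1, hz⟩)
  · by_contra hxV
    exact hg' ⟨(g', x), ⟨⟨hx.1, hxV⟩, hx.2⟩, rfl⟩

theorem GenericallyNull.eventually_residual {h : ℝ} {n : ℕ} {A : Set X} (hA : IsClosed A)
    (hAn : GenericallyNull h n A) :
    ∀ᶠ g : Fin n → C(X, ℝ) in residual _, ∀ ε > 0, ContentLT h ε (A ∩ commonZeros g) := by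
  have : ∀ m : ℕ, ∀ᶠ g : Fin n → C(X, ℝ) in residual _,
      ContentLT h ((m : ℝ≥0∞) + 1)⁻¹ (A ∩ commonZeros g) := fun m =>
    residual_of_dense_open (isOpen_contentLT_commonZeros hA) (hAn _ (by simp))
  filter_upwards [eventually_countable_forall.2 this] with g hg ε hε
  obtain ⟨m, hm⟩ := exists_nat_inv_succ_lt hε
  exact (hg m).mono_right hm.le

/-- If the common zeros of generic `(n + 1)`-tuples are null then for generic `g` so are the common
zeros in `g ⁻¹' {0}` of generic `n`-tuples. -/
theorem GenericallyNull.residual_slice {h : ℝ} {n : ℕ} {A : Set X} (hA : IsClosed A)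
    (hAn : GenericallyNull h (n + 1) A) :
    ∀ᶠ g : C(X, ℝ) in residual _, GenericallyNull h n (A ∩ {x | g x = 0}) := by
  -- A Kuratowski–Ulam argument: density of the good tails is tested on countably many basic open
  -- sets, each giving a dense open condition on the head.
  have key : ∀ m : ℕ, ∀ V ∈ countableBasis (Fin n → C(X, ℝ)), ∀ᶠ g : C(X, ℝ) in residual _,
      ∃ g' ∈ V, ContentLT h ((m : ℝ≥0∞) + 1)⁻¹
        (A ∩ commonZeros (Fin.cons (α := fun _ => C(X, ℝ)) g g')) := by
    intro m V hV
    refine residual_of_dense_open ?_ ?_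
    · have : {g : C(X, ℝ) | ∃ g' ∈ V, ContentLT h ((m : ℝ≥0∞) + 1)⁻¹
          (A ∩ commonZeros (Fin.cons (α := fun _ => C(X, ℝ)) g g'))} =
          ⋃ g' ∈ V, (fun g => Fin.cons (α := fun _ => C(X, ℝ)) g g') ⁻¹'
            {g | ContentLT h ((m : ℝ≥0∞) + 1)⁻¹ (A ∩ commonZeros g)} := by
        ext g
        simp
      change IsOpen {g : C(X, ℝ) | _}
      rw [this]
      exact isOpen_biUnion fun g' _ => (isOpen_contentLT_commonZeros hA).preimage
        (continuous_id.finCons continuous_const)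
    · refine dense_iff_inter_open.2 fun O hO ⟨g₀, hg₀⟩ => ?_
      obtain ⟨g₀', hg₀'⟩ := nonempty_of_mem_countableBasis hV
      have hopen : IsOpen {g : Fin (n + 1) → C(X, ℝ) | g 0 ∈ O ∧ Fin.tail g ∈ V} :=
        (hO.preimage (continuous_apply 0)).inter ((isOpen_of_mem_countableBasis hV).preimage
          (continuous_pi fun i => continuous_apply i.succ))
      obtain ⟨g, hg, hgc⟩ := (hAn ((m : ℝ≥0∞) + 1)⁻¹ (by simp)).inter_open_nonempty _ hopen
        ⟨Fin.cons (α := fun _ => C(X, ℝ)) g₀ g₀', by simpa using ⟨hg₀, hg₀'⟩⟩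
      refine ⟨g 0, hg.1, Fin.tail g, hg.2, ?_⟩
      rw [Fin.cons_self_tail]
      exact hgc
  have key' := fun m : ℕ => (eventually_countable_ball (countable_countableBasis _)).2 (key m)
  filter_upwards [eventually_countable_forall.2 key'] with g hg ε hε
  obtain ⟨m, hm⟩ := exists_nat_inv_succ_lt hε
  refine (isBasis_countableBasis _).dense_iff.2 fun V hV _ => ?_
  obtain ⟨g', hg'V, hg'⟩ := hg m V hV
  refine ⟨g', hg'V, (hg'.mono_right hm.le).mono fun x hx => ⟨hx.1.1, fun i => ?_⟩⟩
  refine Fin.cases ?_ (fun i => ?_) i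
  · exact hx.1.2
  · exact hx.2 i

theorem genericallyNull_univ_of_locally {h : ℝ} (hh : 0 ≤ h) {n : ℕ}
    (hX : ∀ x : X, ∃ N ∈ 𝓝 x, IsClosed N ∧ GenericallyNull h n N) :
    GenericallyNull h n (univ : Set X) := by
  borelize X
  choose N hN hNc hNn using hX
  obtain ⟨s, -, hs⟩ := isCompact_univ.elim_nhds_subcover N fun x _ => hN x
  have hev := (eventually_countable_ball s.countable_toSet).2
    fun x _ => (hNn x).eventually_residual (hNc x)
  refine fun ε hε => (dense_of_mem_residual hev).mono fun g hg => ?_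
  -- Null sets, unlike sets of content below ε, are stable under finite unions.
  refine contentLT_of_hausdorffMeasure_eq_zero hh ?_ hε
  have hsub : univ ∩ commonZeros g ⊆ ⋃ x ∈ (s : Set X), N x ∩ commonZeros g := fun x hx => by
    obtain ⟨y, hy, hxy⟩ := mem_iUnion₂.1 (hs hx.1)
    exact mem_iUnion₂.2 ⟨y, hy, hxy, hx.2⟩
  refine measure_mono_null hsub ((measure_biUnion_null_iff s.countable_toSet).2 fun x hx => ?_)
  exact hausdorffMeasure_eq_zero_of_contentLT hh (hg x hx)

/-- Clamping u - v to [-δ, δ] lets v be replaced by u wherever they are already close, at global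
cost δ. -/
theorem exists_continuousMap_truncate {δ : ℝ} (hδ : 0 ≤ δ) (u v : C(X, ℝ)) :
    ∃ w : C(X, ℝ), ‖w - v‖ ≤ δ ∧ ∀ x, |u x - v x| ≤ δ → w x = u x := by
  refine ⟨⟨fun x => v x + max (-δ) (min δ (u x - v x)), by fun_prop⟩, ?_, fun x hx => ?_⟩
  · refine (ContinuousMap.norm_le _ hδ).2 fun x => ?_
    simp only [ContinuousMap.sub_apply, ContinuousMap.coe_mk, Real.norm_eq_abs, add_sub_cancel_left]
    exact abs_le.2 ⟨le_max_left _ _, max_le (by linarith) (min_le_left _ _)⟩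
  · have := abs_le.1 hx
    simp only [ContinuousMap.coe_mk]
    rw [min_eq_right this.2, max_eq_right this.1]
    ring

end GenericZeros

/-! ### Lower bound: large fibres over a ball. -/

theorem indTopHausdorffDim_le_of_genericallyNull {h : ℝ} (hh : 0 ≤ h) (n : ℕ) (X : Type u)
    [MetricSpace X] [CompactSpace X] (hX : GenericallyNull h n (univ : Set X)) :
    indTopHausdorffDim n X ≤ ((nullBound h + n : ℝ) : EReal) := by
  induction n generalizing X with
  | zero =>
    rw [indTopHausdorffDim, Nat.cast_zero, add_zero]
    refine hausdorffDim_le_of_contentLT hh fun ε hε => ?_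
    obtain ⟨g, hg⟩ := (hX ε hε).nonempty
    exact ContentLT.mono hg fun x _ => ⟨mem_univ x, fun i => i.elim0⟩
  | succ n ih =>
    rw [indTopHausdorffDim]
    split_ifs with hemp
    · refine (EReal.coe_le_coe_iff (x := -1)).2 ?_
      have := neg_one_le_nullBound hh
      push_cast
      linarith [n.cast_nonneg (α := ℝ)]
    refine sInf_le ⟨{V | IsOpen V ∧ indTopHausdorffDim n (frontier V) ≤
      ((nullBound h + (n + 1 : ℕ) : ℝ) : EReal) - 1}, ?_, fun V hV => hV.2⟩
    refine isTopologicalBasis_of_isOpen_of_nhds (fun V hV => hV.1) fun x U hxU hU => ?_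
    obtain ⟨f, hf0, hf1, -⟩ := exists_continuous_zero_one_of_isClosed isClosed_singleton
      hU.isClosed_compl (disjoint_singleton_left.2 (not_not.2 hxU))
    -- Any g within 1/2 of `g₀` is negative at x and positive off U, so {g < 0} is a neighbourhood
    -- of x inside U whose frontier lies in the zero set of g.
    let g₀ : C(X, ℝ) := f - ContinuousMap.const X (1 / 2)
    have hgen := hX.residual_slice isClosed_univ
    obtain ⟨g, hg, hgn⟩ := (dense_of_mem_residual hgen).exists_dist_lt g₀
      (show (0 : ℝ) < 1 / 2 by norm_num)
    have hdist : ∀ y, |f y - 1 / 2 - g y| < 1 / 2 := fun y =>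
      (ContinuousMap.dist_apply_le_dist (f := g₀) (g := g) y).trans_lt hgn
    have hVo : IsOpen {y | g y < 0} := isOpen_lt g.continuous continuous_const
    refine ⟨{y | g y < 0}, ⟨hVo, ?_⟩, ?_, ?_⟩
    · have hfr : frontier {y | g y < 0} ⊆ univ ∩ {y | g y = 0} := fun y hy =>
        ⟨mem_univ y, frontier_lt_subset_eq g.continuous continuous_const hy⟩
      have : CompactSpace (frontier {y | g y < 0}) :=
        isCompact_iff_compactSpace.1 isClosed_frontier.isCompact
      refine (ih _ ((GenericallyNull.mono hg hfr).subtype hh isClosed_frontier)).trans_eq ?_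
      rw [show nullBound h + (n : ℝ) = nullBound h + (n + 1 : ℕ) - 1 by push_cast; ring,
        EReal.coe_sub, EReal.coe_one]
    · have := hdist x
      rw [hf0 (mem_singleton x), abs_lt] at this
      simp only [Pi.zero_apply] at this
      simp only [mem_ofPred_eq]
      linarith
    · intro y hy
      by_contra hyU
      have := hdist y
      rw [hf1 hyU, abs_lt] at this
      simp only [Pi.one_apply] at this
      simp only [mem_ofPred_eq] at hy
      linarith

theorem residual_fibers_not_contentLT {X : Type u} [MetricSpace X] [CompactSpace X] {h : ℝ}
    (hh : 0 ≤ h) {n : ℕ} (hX : ¬ GenericallyNull h n (univ : Set X)) :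
    ∀ᶠ g : Fin n → C(X, ℝ) in residual _, ∃ c : Fin n → ℝ, ∃ r > 0, ∃ ε > 0, ∀ y : Fin n → ℝ,
      (∀ i, |y i - c i| < r) → ¬ ContentLT h ε {x | ∀ i, g i x = y i} := by
  have hloc : ∃ x : X, ∀ N ∈ 𝓝 x, IsClosed N → ¬ GenericallyNull h n N := by
    by_contra! hcon
    exact hX (genericallyNull_univ_of_locally hh hcon)
  obtain ⟨x₀, hx₀⟩ := hloc
  refine mem_of_superset (residual_of_dense_open isOpen_interior ?_) interior_subset
  refine Metric.dense_iff.2 fun f₀ η hη => ?_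
  set N : Set X := {x | ∀ i, |f₀ i x - f₀ i x₀| ≤ η / 4} with hNdef
  have hNcl : IsClosed N := by
    rw [hNdef, ofPred_forall]
    exact isClosed_iInter fun i => isClosed_le (by fun_prop) continuous_const
  have hN : N ∈ 𝓝 x₀ := by
    refine Filter.eventually_all.2 fun i => ?_
    have hc : Continuous fun x => |f₀ i x - f₀ i x₀| := by fun_prop
    have h0 : |f₀ i x₀ - f₀ i x₀| < η / 4 := by simpa using by positivity
    exact (hc.continuousAt.eventually_lt_const h0).mono fun x hx => hx.le
  have hnn := hx₀ N hN hNcl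
  simp only [GenericallyNull, not_forall] at hnn
  obtain ⟨ε, hε, hnd⟩ := hnn
  rw [Metric.dense_iff] at hnd
  push Not at hnd
  obtain ⟨g₀, δ, hδ, hg₀⟩ := hnd
  set M : ℝ := ‖g₀‖ + 1
  have hM : 0 < M := by positivity
  -- With this scale k • `g₀` is at most η/4, as is the oscillation of `f₀` from its value at `x₀`
  -- on N; truncation at η/2 thus plants `f₀ i x₀` + k • `g₀ i` on N.
  set k : ℝ := η / (4 * M) with hk
  have hk0 : 0 < k := by positivity
  have hkg : ∀ i x, |k * g₀ i x| ≤ η / 4 := fun i x => by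
    have h1 : |g₀ i x| ≤ M := ((g₀ i).norm_coe_le_norm x).trans
      ((norm_le_pi_norm g₀ i).trans (by simp [M]))
    rw [abs_mul, abs_of_pos hk0]
    calc k * |g₀ i x| ≤ k * M := by gcongr
      _ = η / 4 := by rw [hk]; field_simp
  choose f hf hfu using fun i => exists_continuousMap_truncate (δ := η / 2) (by positivity)
    (ContinuousMap.const X (f₀ i x₀) + k • g₀ i) (f₀ i)
  have hfN : ∀ i, ∀ x ∈ N, f i x = f₀ i x₀ + k * g₀ i x := fun i x hx => by
    rw [hfu i x]
    · simp
    · have h1 := abs_le.1 (hkg i x)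
      have h2 := abs_le.1 (hx i)
      simp only [ContinuousMap.add_apply, ContinuousMap.const_apply, ContinuousMap.smul_apply,
        smul_eq_mul]
      exact abs_le.2 ⟨by linarith, by linarith⟩
  refine ⟨f, ?_, ?_⟩
  · rw [mem_ball, dist_eq_norm]
    exact ((pi_norm_le_iff_of_nonneg (by positivity)).2 hf).trans_lt (by linarith)
  rw [mem_interior_iff_mem_nhds]
  have hr : 0 < k * δ / 4 := by positivity
  refine mem_of_superset (ball_mem_nhds f hr) fun f' hf' => ?_
  -- On N, (f' - y)/k differs from `g₀` by at most δ/2, hence agrees there with a tuple w in the bad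
  -- ball, whose zeros in N are exactly points of the fibre over y.
  refine ⟨fun i => f₀ i x₀, k * δ / 4, hr, ε, hε, fun y hy hcont => ?_⟩
  choose w hw hwu using fun i => exists_continuousMap_truncate (δ := δ / 2) (by positivity)
    (k⁻¹ • (f' i - ContinuousMap.const X (y i))) (g₀ i)
  have hwN : ∀ i, ∀ x ∈ N, w i x = k⁻¹ * (f' i x - y i) := fun i x hx => by
    rw [hwu i x]
    · simp
    · have h1 : |f' i x - f i x| < k * δ / 4 :=
        (ContinuousMap.dist_apply_le_dist (f := f' i) (g := f i) x).trans_lt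
          ((dist_le_pi_dist f' f i).trans_lt hf')
      have h2 := hy i
      rw [hfN i x hx, abs_lt] at h1
      rw [abs_lt] at h2
      simp only [ContinuousMap.sub_apply, ContinuousMap.const_apply, ContinuousMap.smul_apply,
        smul_eq_mul]
      have h3 : k⁻¹ * (f' i x - y i) - g₀ i x = k⁻¹ * (f' i x - y i - k * g₀ i x) := by
        field_simp
      rw [h3, abs_mul, abs_of_pos (inv_pos.2 hk0), inv_mul_le_iff₀ hk0]
      exact abs_le.2 ⟨by linarith, by linarith⟩
  have hwb : w ∈ ball g₀ δ := by
    rw [mem_ball, dist_eq_norm]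
    exact ((pi_norm_le_iff_of_nonneg (by positivity)).2 hw).trans_lt (by linarith)
  refine (eq_empty_iff_forall_notMem.1 hg₀ w) ⟨hwb, hcont.mono fun x hx i => ?_⟩
  have h4 := hx.2 i
  rw [hwN i x hx.1] at h4
  have := (mul_eq_zero.1 h4).resolve_left (inv_ne_zero hk0.ne')
  linarith

/-! ### Closed sets that split into small clopen parts. -/

section FinePieces

variable {X : Type u} [MetricSpace X]

/-- A closed set with a locally constant labelling whose classes have diameter at most `ε`. -/
def FinePiece (ε : ℝ) (C : Set X) : Prop :=
  IsClosed C ∧ ∃ p : X → ℕ, ContinuousOn p C ∧ ∀ x ∈ C, ∀ y ∈ C, p x = p y → dist x y ≤ ε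

theorem FinePiece.empty (ε : ℝ) : FinePiece ε (∅ : Set X) :=
  ⟨isClosed_empty, fun _ => 0, continuousOn_empty _, by simp⟩

theorem FinePiece.mono {ε ε' : ℝ} {C : Set X} (hC : FinePiece ε C) (h : ε ≤ ε') :
    FinePiece ε' C :=
  let ⟨hcl, p, hp, hd⟩ := hC
  ⟨hcl, p, hp, fun x hx y hy hxy => (hd x hx y hy hxy).trans h⟩

theorem FinePiece.subset {ε : ℝ} {C D : Set X} (hC : FinePiece ε C) (hD : IsClosed D)
    (hDC : D ⊆ C) : FinePiece ε D :=
  let ⟨_, p, hp, hd⟩ := hC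
  ⟨hD, p, hp.mono hDC, fun x hx y hy hxy => hd x (hDC hx) y (hDC hy) hxy⟩

theorem FinePiece.union_of_disjoint {ε : ℝ} {C D : Set X} (hC : FinePiece ε C)
    (hD : FinePiece ε D) (hCD : Disjoint C D) : FinePiece ε (C ∪ D) := by
  classical
  obtain ⟨hCc, p, hp, hpd⟩ := hC
  obtain ⟨hDc, q, hq, hqd⟩ := hD
  have hDC : ∀ x ∈ D, x ∉ C := fun x hx hx' => disjoint_left.1 hCD hx' hx
  -- Parity keeps the two families of labels apart.
  refine ⟨hCc.union hDc, fun x => if x ∈ C then 2 * p x else 2 * q x + 1, ?_, ?_⟩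
  · refine ContinuousOn.union_of_isClosed ?_ ?_ hCc hDc
    · exact (continuousOn_const.mul hp).congr fun x hx => if_pos hx
    · exact ((continuousOn_const.mul hq).add continuousOn_const).congr fun x hx => if_neg (hDC x hx)
  · rintro x (hx | hx) y (hy | hy) hxy
    · simp only [hx, hy, if_true] at hxy
      exact hpd x hx y hy (by omega)
    · simp only [hx, hDC y hy, if_true, if_false] at hxy
      omega
    · simp only [hy, hDC x hx, if_true, if_false] at hxy
      omega
    · simp only [hDC x hx, hDC y hy, if_false] at hxy
      exact hqd x hx y hy (by omega)

/-- A set missing the frontier of U meets U in a relatively clopen set, so the members of the cover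
can be split off one at a time. -/
theorem finePiece_of_cover {ι : Type*} {ε : ℝ} {U : ι → Set X} (s : Finset ι)
    (hU : ∀ i ∈ s, IsOpen (U i)) (hd : ∀ i ∈ s, ∀ x ∈ U i, ∀ y ∈ U i, dist x y ≤ ε) {E : Set X}
    (hE : IsClosed E) (hEU : E ⊆ ⋃ i ∈ s, U i) (hfr : ∀ i ∈ s, Disjoint E (frontier (U i))) :
    FinePiece ε E := by
  classical
  induction s using Finset.induction_on generalizing E with
  | empty =>
    rw [show E = ∅ from subset_empty_iff.1 (by simpa using hEU)]
    exact FinePiece.empty ε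
  | insert i s _ ih =>
    have hcl : IsClosed (E ∩ U i) := by
      have : E ∩ U i = E ∩ closure (U i) := by
        refine (inter_subset_inter_right _ subset_closure).antisymm fun x hx => ⟨hx.1, ?_⟩
        by_contra hxU
        refine disjoint_left.1 (hfr i (Finset.mem_insert_self i s)) hx.1 ?_
        rw [(hU i (Finset.mem_insert_self i s)).frontier_eq]
        exact ⟨hx.2, hxU⟩
      rw [this]
      exact hE.inter isClosed_closure
    have h1 : FinePiece ε (E ∩ U i) := ⟨hcl, fun _ => 0, continuousOn_const, fun x hx y hy _ =>
      hd i (Finset.mem_insert_self i s) x hx.2 y hy.2⟩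
    have h2 : FinePiece ε (E \ U i) := by
      refine ih (fun j hj => hU j (Finset.mem_insert_of_mem hj))
        (fun j hj => hd j (Finset.mem_insert_of_mem hj))
        (hE.sdiff (hU i (Finset.mem_insert_self i s))) (fun x hx => ?_)
        (fun j hj => (hfr j (Finset.mem_insert_of_mem hj)).mono_left sdiff_subset)
      obtain ⟨j, hj, hxj⟩ := mem_iUnion₂.1 (hEU hx.1)
      rcases Finset.mem_insert.1 hj with rfl | hj
      · exact absurd hxj hx.2
      · exact mem_iUnion₂.2 ⟨j, hj, hxj⟩
    have := h1.union_of_disjoint h2 (disjoint_left.2 fun x hx hx' => hx'.2 hx.2)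
    rwa [inter_union_sdiff] at this

theorem FinePiece.image_val {ε : ℝ} {A : Set X} (hA : IsClosed A) {C : Set A}
    (hC : FinePiece ε C) : FinePiece ε ((↑) '' C : Set X) := by
  classical
  obtain ⟨hcl, p, hp, hd⟩ := hC
  have hpx : ∀ x : A, (if h : (x : X) ∈ A then p ⟨x, h⟩ else 0) = p x := fun x => by simp
  refine ⟨hA.isClosedMap_subtype_val _ hcl, fun x => if h : x ∈ A then p ⟨x, h⟩ else 0, ?_, ?_⟩
  · refine (Topology.IsInducing.subtypeVal (t := A)).continuousOn_image_iff.2 ?_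
    exact hp.congr fun x _ => hpx x
  · rintro _ ⟨x, hx, rfl⟩ _ ⟨y, hy, rfl⟩ hxy
    exact hd x hx y hy ((hpx x).symm.trans (hxy.trans (hpx y)))

variable [CompactSpace X]

theorem FinePiece.exists_cthickening {ε ε' : ℝ} {C : Set X} (hC : FinePiece ε C) (h : ε < ε') :
    ∃ r > 0, FinePiece ε' (cthickening r C) := by
  classical
  obtain ⟨hcl, p, hp, hd⟩ := hC
  have huc := Metric.uniformContinuousOn_iff.1
    (hcl.isCompact.uniformContinuousOn_of_continuous hp) 1 one_pos
  obtain ⟨δ, hδ, hpδ⟩ := huc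
  have hpδ' : ∀ x ∈ C, ∀ y ∈ C, dist x y < δ → p x = p y := fun x hx y hy hxy => by
    by_contra hne
    exact absurd (hpδ x hx y hy hxy) (not_lt.2 (Nat.pairwise_one_le_dist hne))
  -- Nearest-point labels compare points at distance below 3r < δ, and diameters grow by at most 2r
  -- ≤ ε' - ε.
  set r := min (δ / 4) ((ε' - ε) / 2)
  have hr : 0 < r := lt_min (by positivity) (by linarith)
  have hrδ : r ≤ δ / 4 := min_le_left _ _
  have hrε : r ≤ (ε' - ε) / 2 := min_le_right _ _
  have hex : ∀ x, ∃ c, x ∈ cthickening r C → c ∈ C ∧ dist x c ≤ r := fun x => by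
    by_cases hx : x ∈ cthickening r C
    · rw [hcl.isCompact.cthickening_eq_biUnion_closedBall hr.le] at hx
      obtain ⟨c, hc, hxc⟩ := mem_iUnion₂.1 hx
      exact ⟨c, fun _ => ⟨hc, hxc⟩⟩
    · exact ⟨x, fun h => absurd h hx⟩
  choose c hc using hex
  refine ⟨r, hr, isClosed_cthickening, fun x => p (c x), fun x hx => ?_, fun x hx y hy hxy => ?_⟩
  · refine tendsto_const_nhds.congr' ?_
    filter_upwards [self_mem_nhdsWithin, mem_nhdsWithin_of_mem_nhds (ball_mem_nhds x hr)]
      with y hy hyx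
    refine hpδ' _ (hc x hx).1 _ (hc y hy).1 ?_
    have h1 := dist_triangle4 (c x) x y (c y)
    have h2 := (hc x hx).2
    have h3 := (hc y hy).2
    rw [mem_ball, dist_comm] at hyx
    rw [dist_comm] at h2
    linarith
  · have h1 := dist_triangle4 x (c x) (c y) y
    have h2 := (hc x hx).2
    have h3 := (hc y hy).2
    have h4 := hd _ (hc x hx).1 _ (hc y hy).1 hxy
    rw [dist_comm] at h3
    linarith

theorem FinePiece.exists_union {ε ε' : ℝ} {C : Set X} (hC : FinePiece ε C) (h : ε < ε')
    (hε' : 0 < ε') : ∃ δ > 0, ∀ D : Set X, FinePiece δ D → FinePiece ε' (C ∪ D) := by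
  obtain ⟨r, hr, hrC⟩ := hC.exists_cthickening h
  refine ⟨min r ε', lt_min hr hε', fun D hD => ?_⟩
  obtain ⟨hDc, q, hq, hqd⟩ := hD
  -- Parts of D meeting C lie in the thickening of C and inherit its splitting; the remaining parts
  -- are disjoint from C.
  set S : Set ℕ := q '' (C ∩ D)
  have hcl : ∀ T : Set ℕ, IsClosed (D ∩ q ⁻¹' T) := fun T =>
    hq.preimage_isClosed_of_isClosed hDc (isClosed_discrete T)
  have h1 : FinePiece ε' (C ∪ D ∩ q ⁻¹' S) := by
    refine hrC.subset (hC.1.union (hcl S)) (union_subset (self_subset_cthickening C) ?_)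
    rintro x ⟨hxD, c, hc, hcx⟩
    exact mem_cthickening_of_dist_le x c r C hc.1
      ((hqd x hxD c hc.2 hcx.symm).trans (min_le_left _ _))
  have h2 : FinePiece ε' (D ∩ q ⁻¹' Sᶜ) := by
    refine FinePiece.subset ?_ (hcl _) inter_subset_left
    exact ⟨hDc, q, hq, fun x hx y hy hxy => (hqd x hx y hy hxy).trans (min_le_right _ _)⟩
  have hdis : Disjoint (C ∪ D ∩ q ⁻¹' S) (D ∩ q ⁻¹' Sᶜ) := by
    refine disjoint_left.2 ?_
    rintro x (hx | hx) hx'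
    · exact hx'.2 ⟨x, ⟨hx, hx'.1⟩, rfl⟩
    · exact hx'.2 hx.2
  have := h1.union_of_disjoint h2 hdis
  rwa [union_assoc, ← inter_union_distrib_left, preimage_compl, union_compl_self, inter_univ]
    at this

end FinePieces

/-! ### Covers by n fine pieces, and the small exceptional set. -/

section FineCovers

variable {X : Type u} [MetricSpace X]

/-- `F` is covered by `n` closed sets, each splitting into clopen parts of diameter at most `ε`. -/
def FineCover (n : ℕ) (ε : ℝ) (F : Set X) : Prop :=
  ∃ C : Fin n → Set X, (∀ i, FinePiece ε (C i)) ∧ F ⊆ ⋃ i, C i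

theorem FineCover.empty (n : ℕ) (ε : ℝ) : FineCover n ε (∅ : Set X) :=
  ⟨fun _ => ∅, fun _ => FinePiece.empty ε, empty_subset _⟩

theorem FineCover.mono {n : ℕ} {ε : ℝ} {E F : Set X} (hF : FineCover n ε F) (h : E ⊆ F) :
    FineCover n ε E :=
  let ⟨C, hC, hFC⟩ := hF
  ⟨C, hC, h.trans hFC⟩

theorem FineCover.image_val {n : ℕ} {ε : ℝ} {A : Set X} (hA : IsClosed A) {F : Set A}
    (hF : FineCover n ε F) : FineCover n ε ((↑) '' F : Set X) := by
  obtain ⟨C, hC, hFC⟩ := hF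
  refine ⟨fun i => (↑) '' C i, fun i => (hC i).image_val hA, ?_⟩
  rw [← image_iUnion]
  exact image_mono hFC

variable [CompactSpace X]

/-- The i-th pieces of both covers are merged, the second cover being chosen after the first at a
fine enough scale; the number of pieces stays n. -/
theorem FineCover.union {n : ℕ} {E F : Set X} (hE : ∀ ε > 0, FineCover n ε E)
    (hF : ∀ ε > 0, FineCover n ε F) {ε : ℝ} (hε : 0 < ε) : FineCover n ε (E ∪ F) := by
  obtain ⟨C, hC, hEC⟩ := hE (ε / 2) (by positivity)
  choose δ hδ hδC using fun i => (hC i).exists_union (half_lt_self hε) hε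
  obtain ⟨η, hη, hηδ⟩ : ∃ η > 0, ∀ i, η ≤ δ i := by
    rcases isEmpty_or_nonempty (Fin n) with _ | _
    · exact ⟨1, one_pos, fun i => isEmptyElim i⟩
    · obtain ⟨i, hi⟩ := Finite.exists_min δ
      exact ⟨δ i, hδ i, hi⟩
  obtain ⟨D, hD, hFD⟩ := hF η hη
  refine ⟨fun i => C i ∪ D i, fun i => hδC i _ ((hD i).mono (hηδ i)), ?_⟩
  rw [iUnion_union_distrib]
  exact union_subset_union hEC hFD

theorem FineCover.biUnion {ι : Type*} {n : ℕ} (s : Finset ι) {F : ι → Set X}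
    (hF : ∀ i ∈ s, ∀ ε > 0, FineCover n ε (F i)) {ε : ℝ} (hε : 0 < ε) :
    FineCover n ε (⋃ i ∈ s, F i) := by
  classical
  induction s using Finset.induction_on generalizing ε with
  | empty => simpa using FineCover.empty n ε
  | insert i s _ ih =>
    rw [Finset.set_biUnion_insert]
    exact FineCover.union (hF i (Finset.mem_insert_self i s))
      (fun η hη => ih (fun j hj => hF j (Finset.mem_insert_of_mem hj)) hη) hε

end FineCovers

/-- Away from a set of small Hausdorff dimension, a compact space is covered by `n` fine pieces. -/
theorem exists_dimH_le_fineCover (n : ℕ) (X : Type u) [MetricSpace X] [CompactSpace X] (t : ℝ)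
    (hX : indTopHausdorffDim n X < ((t + n : ℝ) : EReal)) :
    ∃ L : Set X, dimH L ≤ ENNReal.ofReal t ∧
      ∀ F, IsClosed F → Disjoint F L → ∀ ε > 0, FineCover n ε F := by
  induction n generalizing X with
  | zero =>
    refine ⟨univ, ?_, fun F _ hF ε _ => ?_⟩
    · rcases isEmpty_or_nonempty X with hemp | hne
      · rw [univ_eq_empty_iff.2 hemp, dimH_empty]
        exact zero_le
      rw [indTopHausdorffDim, Nat.cast_zero, add_zero, hausdorffDim_of_nonempty univ_nonempty] at hX
      have ht : 0 ≤ t := by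
        have := (EReal.coe_ennreal_nonneg _).trans hX.le
        exact_mod_cast this
      rw [← EReal.coe_ennreal_le_coe_ennreal_iff, EReal.coe_ennreal_ofReal, max_eq_left ht]
      exact hX.le
    · rw [disjoint_univ.1 hF]
      exact FineCover.empty 0 ε
  | succ n ih =>
    rw [indTopHausdorffDim] at hX
    split_ifs at hX with hemp
    · refine ⟨∅, by simp, fun F _ _ ε _ => ?_⟩
      rw [eq_empty_of_isEmpty F]
      exact FineCover.empty _ ε
    obtain ⟨d, ⟨B, hB, hBd⟩, hd⟩ := sInf_lt_iff.1 hX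
    have hd' : d - 1 < ((t + n : ℝ) : EReal) := by
      have h1 : ((t + (n + 1 : ℕ) : ℝ) : EReal) = ((t + n : ℝ) : EReal) + 1 := by
        rw [← EReal.coe_one, ← EReal.coe_add]
        congr 1
        push_cast
        ring
      rw [h1] at hd
      exact EReal.sub_lt_of_lt_add' (by rwa [add_comm])
    -- Countability keeps the union of the exceptional sets of the boundaries at dimension at most
    -- t.
    obtain ⟨B', hB'B, hB'c, hB'⟩ := hB.exists_countable
    have hL : ∀ U : Set X, ∃ L : Set (frontier U), U ∈ B' → dimH L ≤ ENNReal.ofReal t ∧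
        ∀ F, IsClosed F → Disjoint F L → ∀ ε > 0, FineCover n ε F := fun U => by
      by_cases hU : U ∈ B'
      · have : CompactSpace (frontier U) :=
          isCompact_iff_compactSpace.1 isClosed_frontier.isCompact
        obtain ⟨L, hL⟩ := ih (frontier U) ((hBd U (hB'B hU)).trans_lt hd')
        exact ⟨L, fun _ => hL⟩
      · exact ⟨∅, fun h => absurd h hU⟩
    choose L hL using hL
    refine ⟨⋃ U ∈ B', (↑) '' L U, ?_, fun F hF hFL ε hε => ?_⟩
    · rw [dimH_bUnion hB'c]
      refine iSup₂_le fun U hU => ?_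
      rw [isometry_subtype_coe.dimH_image]
      exact (hL U hU).1
    have hfrF : ∀ U ∈ B', ∀ η > 0, FineCover n η (F ∩ frontier U) := fun U hU η hη => by
      rw [inter_comm, ← Subtype.image_preimage_coe]
      refine ((hL U hU).2 _ (hF.preimage continuous_subtype_val) ?_ η hη).image_val
        isClosed_frontier
      refine disjoint_left.2 fun x hx hxL => disjoint_left.1 hFL hx ?_
      exact mem_iUnion₂.2 ⟨U, hU, x, hxL, rfl⟩
    have hcov : ∀ x : X, ∃ U ∈ B', x ∈ U ∧ U ⊆ ball x (ε / 2) := fun x =>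
      hB'.exists_subset_of_mem_open (mem_ball_self (by positivity)) isOpen_ball
    choose U hUB hxU hUball using hcov
    obtain ⟨s, hs⟩ := isCompact_univ.elim_finite_subcover U (fun x => hB'.isOpen (hUB x))
      (fun x _ => mem_iUnion.2 ⟨x, hxU x⟩)
    -- The boundaries use n pieces; what is left of F after thickening these misses every frontier
    -- and is the one additional piece.
    obtain ⟨C, hC, hHC⟩ := FineCover.biUnion s (F := fun x => F ∩ frontier (U x))
      (fun x _ => hfrF _ (hUB x)) (half_pos hε)
    choose r hr hrC using fun i => (hC i).exists_cthickening (half_lt_self hε)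
    have hE : FinePiece ε (F \ ⋃ i, thickening (r i) (C i)) := by
      refine finePiece_of_cover s (fun x _ => hB'.isOpen (hUB x)) (fun x _ y hy z hz => ?_)
        (hF.sdiff (isOpen_iUnion fun i => isOpen_thickening))
        ((subset_univ _).trans hs) (fun x hx => ?_)
      · have h1 := hUball x hy
        have h2 := hUball x hz
        rw [mem_ball] at h1 h2
        linarith [dist_triangle_right y z x]
      · refine disjoint_left.2 fun y hy hyU => hy.2 ?_
        obtain ⟨i, hi⟩ := mem_iUnion.1 (hHC (mem_iUnion₂.2 ⟨x, hx, hy.1, hyU⟩))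
        exact mem_iUnion.2 ⟨i, self_subset_thickening (hr i) _ hi⟩
    refine ⟨Fin.cons (α := fun _ => Set X) (F \ ⋃ i, thickening (r i) (C i))
      fun i => cthickening (r i) (C i), fun i => ?_, fun x hx => ?_⟩
    · refine Fin.cases ?_ (fun i => ?_) i
      · exact hE
      · exact hrC i
    · by_cases hxC : x ∈ ⋃ i, thickening (r i) (C i)
      · obtain ⟨i, hi⟩ := mem_iUnion.1 hxC
        exact mem_iUnion.2 ⟨i.succ, thickening_subset_cthickening _ _ hi⟩
      · exact mem_iUnion.2 ⟨0, hx, hxC⟩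

/-! ### Separating points of a fibre by perturbation. -/

section GenericFibers

theorem exists_injective_near (c : ℕ → ℝ) {η : ℝ} (hη : 0 < η) :
    ∃ c' : ℕ → ℝ, Function.Injective c' ∧ ∀ m, |c' m - c m| ≤ η := by
  have hcount : (range fun q : ℕ × ℕ =>
      (c q.2 - c q.1) / (((q.1 : ℝ) + 1)⁻¹ - ((q.2 : ℝ) + 1)⁻¹)).Countable := countable_range _
  -- Two of the values c m + t/(m+1) collide for only countably many t.
  obtain ⟨t, ht, htη⟩ : ∃ t ∈ Ioo 0 η, t ∉ range fun q : ℕ × ℕ =>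
      (c q.2 - c q.1) / (((q.1 : ℝ) + 1)⁻¹ - ((q.2 : ℝ) + 1)⁻¹) := by
    by_contra! hcon
    have := hcount.mono hcon
    exact absurd this (Cardinal.Real.Ioo_countable_iff.not.2 (not_le.2 hη))
  refine ⟨fun m => c m + t * ((m : ℝ) + 1)⁻¹, fun m k hmk => ?_, fun m => ?_⟩
  · by_contra hne
    refine htη ⟨(m, k), ?_⟩
    have h0 : ((m : ℝ) + 1)⁻¹ - ((k : ℝ) + 1)⁻¹ ≠ 0 := by
      rw [sub_ne_zero]
      intro h
      exact hne (by exact_mod_cast add_right_cancel (inv_injective h))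
    simp only at hmk ⊢
    rw [div_eq_iff h0]
    linarith
  · rw [add_sub_cancel_left, abs_of_nonneg (by have := ht.1; positivity)]
    have : ((m : ℝ) + 1)⁻¹ ≤ 1 := inv_le_one_of_one_le₀ (by linarith [m.cast_nonneg (α := ℝ)])
    nlinarith [ht.1, ht.2]

variable {X : Type u} [MetricSpace X] [CompactSpace X]

/-- Since g nearly is constant on each part, it can be made constant there, with distinct values on
distinct parts. -/
theorem FinePiece.exists_separating {ρ η : ℝ} {C : Set X} (hC : FinePiece ρ C) (hη : 0 < η)
    (g : C(X, ℝ)) (hg : ∀ x y, dist x y ≤ ρ → |g x - g y| ≤ η / 2) :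
    ∃ w : C(X, ℝ), ‖w - g‖ ≤ η ∧ ∀ x ∈ C, ∀ y ∈ C, w x = w y → dist x y ≤ ρ := by
  classical
  obtain ⟨hcl, p, hp, hd⟩ := hC
  have hrep : ∀ m, ∃ c : ℝ, ∀ x ∈ C, p x = m → |c - g x| ≤ η / 2 := fun m => by
    by_cases h : ∃ y ∈ C, p y = m
    · obtain ⟨y, hy, rfl⟩ := h
      exact ⟨g y, fun x hx hxy => hg y x (hd y hy x hx hxy.symm)⟩
    · exact ⟨0, fun x hx hxm => absurd ⟨x, hx, hxm⟩ h⟩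
  choose c hc using hrep
  obtain ⟨c', hinj, hc'⟩ := exists_injective_near c (half_pos hη)
  obtain ⟨u, hu⟩ := ContinuousMap.exists_restrict_eq hcl
    (⟨fun x => c' (p x), (continuous_of_discreteTopology (f := c')).comp
      (continuousOn_iff_continuous_domRestrict.1 hp)⟩ : C(C, ℝ))
  have huC : ∀ x ∈ C, u x = c' (p x) := fun x hx => congrArg (fun f => f ⟨x, hx⟩) hu
  obtain ⟨w, hw, hwu⟩ := exists_continuousMap_truncate hη.le u g
  have hwC : ∀ x ∈ C, w x = c' (p x) := fun x hx => by
    rw [← huC x hx]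
    refine hwu x ?_
    rw [huC x hx]
    have h1 := hc' (p x)
    have h2 := hc (p x) x hx rfl
    have := abs_sub_le (c' (p x)) (c (p x)) (g x)
    linarith
  refine ⟨w, hw, fun x hx y hy hxy => hd x hx y hy (hinj ?_)⟩
  rw [← hwC x hx, ← hwC y hy, hxy]

/-- Generically, among `n + 1` points of `F` in a common fibre two are closer than `ε`. -/
theorem residual_exists_dist_lt {n : ℕ} {F : Set X} (hF : IsClosed F)
    (hcov : ∀ ε > 0, FineCover n ε F) {ε : ℝ} (hε : 0 < ε) :
    ∀ᶠ g : Fin n → C(X, ℝ) in residual _, ∀ x : Fin (n + 1) → X, (∀ j, x j ∈ F) →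
      (∀ i j k, g i (x j) = g i (x k)) → ∃ j k, j ≠ k ∧ dist (x j) (x k) < ε := by
  refine residual_of_dense_open ?_ ?_
  -- Openness: the bad maps are the projection of a closed set along the compact space X^(n+1).
  · have hcl : IsClosed {q : (Fin n → C(X, ℝ)) × (Fin (n + 1) → X) |
        (∀ j, q.2 j ∈ F) ∧ (∀ i j k, q.1 i (q.2 j) = q.1 i (q.2 k)) ∧
          ∀ j k, j ≠ k → ε ≤ dist (q.2 j) (q.2 k)} := by
      simp only [ofPred_and, ofPred_forall]
      refine (isClosed_iInter fun j => hF.preimage ((continuous_apply j).comp continuous_snd)).inter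
        ((isClosed_iInter fun i => isClosed_iInter fun j => isClosed_iInter fun k => ?_).inter
        (isClosed_iInter fun j => isClosed_iInter fun k => isClosed_iInter fun _ => ?_))
      · have hc : ∀ l : Fin (n + 1),
            Continuous fun q : (Fin n → C(X, ℝ)) × (Fin (n + 1) → X) => q.1 i (q.2 l) := fun l =>
          ((continuous_apply i).comp continuous_fst).eval ((continuous_apply l).comp continuous_snd)
        exact isClosed_eq (hc j) (hc k)
      · exact isClosed_le continuous_const (((continuous_apply j).comp continuous_snd).dist
          ((continuous_apply k).comp continuous_snd))
    convert (isClosedMap_fst_of_compactSpace _ hcl).isOpen_compl using 1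
    ext g
    constructor
    · rintro hg ⟨⟨g', x⟩, ⟨hxF, hx, hxd⟩, rfl⟩
      obtain ⟨j, k, hjk, hd⟩ := hg x hxF hx
      exact absurd (hxd j k hjk) (not_le.2 hd)
    · intro hg x hxF hx
      by_contra! hcon
      exact hg ⟨(g, x), ⟨hxF, hx, hcon⟩, rfl⟩
  · refine Metric.dense_iff.2 fun g η hη => ?_
    have huc : ∀ i, ∃ ρ > 0, ∀ x y, dist x y < ρ → |g i x - g i y| < η / 4 := fun i => by
      obtain ⟨ρ, hρ, h⟩ := Metric.uniformContinuous_iff.1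
        (CompactSpace.uniformContinuous_of_continuous (g i).continuous) (η / 4) (by positivity)
      exact ⟨ρ, hρ, fun x y hxy => h hxy⟩
    choose ρ hρ hgρ using huc
    obtain ⟨σ, hσ, hσρ, hσε⟩ : ∃ σ > 0, (∀ i, σ < ρ i) ∧ σ < ε := by
      rcases isEmpty_or_nonempty (Fin n) with _ | _
      · exact ⟨ε / 2, by positivity, fun i => isEmptyElim i, half_lt_self hε⟩
      · obtain ⟨i, hi⟩ := Finite.exists_min ρ
        have := lt_min (hρ i) hε
        refine ⟨min (ρ i) ε / 2, by positivity, fun j => ?_, ?_⟩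
        · exact (half_lt_self this).trans_le ((min_le_left _ _).trans (hi j))
        · exact (half_lt_self this).trans_le (min_le_right _ _)
    obtain ⟨C, hC, hFC⟩ := hcov σ hσ
    choose w hw hwC using fun i => (hC i).exists_separating (half_pos hη) (g i)
      fun x y hxy => ((hgρ i x y (hxy.trans_lt (hσρ i))).le.trans (by linarith))
    refine ⟨w, ?_, fun x hxF hx => ?_⟩
    · rw [mem_ball, dist_eq_norm]
      exact ((pi_norm_le_iff_of_nonneg (by positivity)).2 hw).trans_lt (half_lt_self hη)
    choose i hi using fun j => mem_iUnion.1 (hFC (hxF j))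
    -- Two of the n + 1 points share a piece `C i`, and `w i` alone already forces them to be close.
    obtain ⟨j, k, hjk, hijk⟩ := Fintype.exists_ne_map_eq_of_card_lt i (by simp)
    refine ⟨j, k, hjk, (hwC (i j) _ (hi j) _ ?_ (hx _ _ _)).trans_lt hσε⟩
    rw [hijk]
    exact hi k

end GenericFibers

/-- This turns n ≤ dim_t into n ≤ dim_{t^nH}: both follow the same recursion on boundaries, and a
negative Hausdorff dimension means empty. -/
theorem hasSmallInductiveDimensionLT_of_indTopHausdorffDim_lt (n : ℕ) (X : Type u) [MetricSpace X]
    (hX : indTopHausdorffDim n X < (n : EReal)) : HasSmallInductiveDimensionLT X n := by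
  induction n generalizing X with
  | zero =>
    rw [hasSmallInductiveDimensionLT_zero_iff]
    by_contra hne
    rw [not_isEmpty_iff] at hne
    rw [indTopHausdorffDim, hausdorffDim_of_nonempty univ_nonempty] at hX
    exact absurd hX (not_lt.2 (by simpa using EReal.coe_ennreal_nonneg _))
  | succ n ih =>
    rw [indTopHausdorffDim] at hX
    split_ifs at hX with hemp
    · infer_instance
    obtain ⟨d, ⟨B, hB, hBd⟩, hd⟩ := sInf_lt_iff.1 hX
    refine .succ n B hB fun U hU => ih _ ((hBd U hU).trans_lt ?_)
    refine EReal.sub_lt_of_lt_add' ?_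
    rwa [add_comm, ← Nat.cast_one, ← Nat.cast_add]

/-! ### The exceptional G_δ set and the two fibre bounds. -/

section Fibers

variable {X : Type u} [MetricSpace X] [CompactSpace X]

/-- Given n + 1 distinct points lie in finitely many of the sets and have positive mutual distances,
so finite subunions and scales 1/(m+1) suffice. -/
theorem residual_encard_fiber_le {ι : Type*} [Countable ι] {n : ℕ} {F : ι → Set X}
    (hF : ∀ i, IsClosed (F i)) (hcov : ∀ i, ∀ ε > 0, FineCover n ε (F i)) :
    ∀ᶠ g : Fin n → C(X, ℝ) in residual _, ∀ y : Fin n → ℝ,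
      ({x | ∀ i, g i x = y i} ∩ ⋃ i, F i).encard ≤ n := by
  classical
  have key : ∀ (s : Finset ι) (m : ℕ), ∀ᶠ g : Fin n → C(X, ℝ) in residual _,
      ∀ x : Fin (n + 1) → X, (∀ j, x j ∈ ⋃ i ∈ s, F i) → (∀ i j k, g i (x j) = g i (x k)) →
        ∃ j k, j ≠ k ∧ dist (x j) (x k) < 1 / ((m : ℝ) + 1) := fun s m =>
    residual_exists_dist_lt (s.finite_toSet.isClosed_biUnion fun i _ => hF i)
      (fun ε hε => FineCover.biUnion s (fun i _ => hcov i) hε) (by positivity)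
  filter_upwards [eventually_countable_forall.2 fun s => eventually_countable_forall.2 (key s)]
    with g hg y
  by_contra! hcon
  obtain ⟨T, hT, hTc⟩ := exists_subset_encard_eq (Order.add_one_le_of_lt hcon)
  have hTfin : T.Finite := finite_of_encard_le_coe (k := n + 1) (by rw [hTc]; norm_cast)
  lift T to Finset X using hTfin
  rw [encard_coe_eq_coe_finsetCard] at hTc
  have hcard : T.card = n + 1 := by exact_mod_cast hTc
  let e := T.equivFinOfCardEq hcard
  have hx : ∀ j, ((e.symm j : T) : X) ∈ {x | ∀ i, g i x = y i} ∩ ⋃ i, F i := fun j =>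
    hT (e.symm j).2
  choose l hl using fun j => mem_iUnion.1 (hx j).2
  have hlim : ∀ᶠ m : ℕ in atTop, ∀ j k : Fin (n + 1), j ≠ k →
      1 / ((m : ℝ) + 1) < dist ((e.symm j : T) : X) (e.symm k : T) := by
    refine eventually_all.2 fun j => eventually_all.2 fun k => ?_
    by_cases hjk : j = k
    · exact Eventually.of_forall fun m h => absurd hjk h
    · have hpos : 0 < dist ((e.symm j : T) : X) (e.symm k : T) := dist_pos.2 fun h =>
        hjk (e.symm.injective (Subtype.ext h))
      filter_upwards [tendsto_one_div_add_atTop_nhds_zero_nat.eventually_lt_const hpos]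
        with m hm _ using hm
  obtain ⟨m, hm⟩ := hlim.exists
  obtain ⟨j, k, hjk, hd⟩ := hg (Finset.univ.image l) m (fun j => ((e.symm j : T) : X))
    (fun j => mem_iUnion₂.2 ⟨l j, Finset.mem_image_of_mem _ (Finset.mem_univ j), hl j⟩)
    (fun i j k => ((hx j).1 i).trans ((hx k).1 i).symm)
  exact absurd hd (not_lt.2 (hm j k hjk).le)

theorem exists_isGδ_residual_encard_le [Nonempty X] {n : ℕ}
    (hX : (n : EReal) ≤ indTopHausdorffDim n X) :
    ∃ G : Set X, IsGδ G ∧ G.Nonempty ∧ hausdorffDim G ≤ indTopHausdorffDim n X - (n : EReal) ∧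
      ∀ᶠ g : Fin n → C(X, ℝ) in residual _, ∀ y : Fin n → ℝ,
        ({x | ∀ i, g i x = y i} \ G).encard ≤ n := by
  rcases eq_or_ne (indTopHausdorffDim n X) ⊤ with htop | htop
  · refine ⟨univ, .univ, univ_nonempty, ?_, Eventually.of_forall fun g y => by simp⟩
    rw [htop, ← EReal.coe_natCast, EReal.top_sub_coe]
    exact le_top
  obtain ⟨s, hs⟩ : ∃ s : ℝ≥0, indTopHausdorffDim n X = ((s + n : ℝ) : EReal) := by
    have hbot : indTopHausdorffDim n X ≠ ⊥ := fun h => by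
      rw [h] at hX
      exact absurd hX (not_le.2 (EReal.bot_lt_coe (n : ℝ)))
    lift indTopHausdorffDim n X to ℝ using ⟨htop, hbot⟩ with D
    have hD : (n : ℝ) ≤ D := EReal.coe_le_coe_iff.1 hX
    refine ⟨⟨D - n, sub_nonneg.2 hD⟩, congrArg Real.toEReal ?_⟩
    exact (sub_add_cancel D (n : ℝ)).symm
  have hL : ∀ k : ℕ, indTopHausdorffDim n X <
      (((s + ((k : ℝ≥0) + 1)⁻¹ : ℝ≥0) + n : ℝ) : EReal) := fun k => by
    rw [hs, EReal.coe_lt_coe_iff]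
    push_cast
    have : (0 : ℝ) < ((k : ℝ) + 1)⁻¹ := by positivity
    linarith
  choose L hLd hLF using fun k => exists_dimH_le_fineCover n X _ (hL k)
  choose H hHG hLH hHd using fun k => exists_isGδ_superset_dimH_le (L k)
    (by simpa only [ENNReal.ofReal_coe_nnreal] using hLd k)
  choose O hOo hHO using fun k => isGδ_iff_eq_iInter_nat.1 (hHG k)
  -- Adding a point ensures that G has dimension at least 0 instead of -1.
  obtain ⟨x₀⟩ := ‹Nonempty X›
  have hG : dimH ((⋂ k, H k) ∪ {x₀}) ≤ s := by
    rw [dimH_union, dimH_singleton]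
    refine max_le (ENNReal.le_of_forall_pos_le_add fun ε hε _ => ?_) zero_le
    obtain ⟨k, hk'⟩ := exists_nat_gt (ε⁻¹)
    refine (dimH_mono (iInter_subset H k)).trans ((hHd k).trans ?_)
    norm_cast
    gcongr
    exact inv_le_of_inv_le₀ hε (hk'.le.trans (by exact_mod_cast k.le_succ))
  refine ⟨(⋂ k, H k) ∪ {x₀}, (IsGδ.iInter hHG).union (IsGδ.singleton x₀),
    ⟨x₀, Or.inr rfl⟩, ?_, ?_⟩
  · rw [hausdorffDim_of_nonempty ⟨x₀, Or.inr rfl⟩, hs, ← EReal.coe_natCast, ← EReal.coe_sub,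
      add_sub_cancel_right]
    exact EReal.coe_ennreal_le_coe_ennreal_iff.2 hG
  · have hF := residual_encard_fiber_le (n := n) (F := fun q : ℕ × ℕ => (O q.1 q.2)ᶜ)
      (fun q => (hOo q.1 q.2).isClosed_compl)
      (fun q => hLF q.1 _ (hOo q.1 q.2).isClosed_compl (disjoint_left.2 fun x hx hxL =>
        hx (mem_iInter.1 (hHO q.1 ▸ hLH q.1 hxL) q.2)))
    filter_upwards [hF] with g hg y
    refine le_trans (encard_le_encard ?_) (hg y)
    refine fun x hx => ⟨hx.1, ?_⟩
    by_contra hcon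
    refine hx.2 (Or.inl (mem_iInter.2 fun k => ?_))
    rw [hHO k]
    refine mem_iInter.2 fun m => ?_
    by_contra hxO
    exact hcon (mem_iUnion.2 ⟨(k, m), hxO⟩)

theorem residual_le_hausdorffDim_fiber {n : ℕ} (hX : (n : EReal) ≤ indTopHausdorffDim n X) :
    ∀ᶠ g : Fin n → C(X, ℝ) in residual _, ∀ d : ℝ, (d : EReal) < indTopHausdorffDim n X →
      ∃ c : Fin n → ℝ, ∃ r > 0, ∀ y : Fin n → ℝ, (∀ i, |y i - c i| < r) →
        (d : EReal) - (n : EReal) ≤ hausdorffDim {x | ∀ i, g i x = y i} := by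
  have key : ∀ q : ℚ, 0 ≤ (q : ℝ) →
      ((nullBound q + n : ℝ) : EReal) < indTopHausdorffDim n X →
      ∀ᶠ g : Fin n → C(X, ℝ) in residual _, ∃ c : Fin n → ℝ, ∃ r > 0, ∀ y : Fin n → ℝ,
        (∀ i, |y i - c i| < r) → ((q : ℝ) : EReal) ≤ hausdorffDim {x | ∀ i, g i x = y i} := by
    intro q hq hlt
    have hnot : ¬ GenericallyNull (q : ℝ) n (univ : Set X) := fun h =>
      absurd (indTopHausdorffDim_le_of_genericallyNull hq n X h) (not_le.2 hlt)
    filter_upwards [residual_fibers_not_contentLT hq hnot] with g ⟨c, r, hr, ε, hε, hg⟩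
    exact ⟨c, r, hr, fun y hy => le_hausdorffDim_of_not_contentLT hq hε (hg y hy)⟩
  simp only [← eventually_imp_distrib_left] at key
  filter_upwards [eventually_countable_forall.2 key] with g hg d hd
  obtain ⟨q, hq, hqX, hdq⟩ : ∃ q : ℚ, 0 ≤ (q : ℝ) ∧
      ((nullBound q + n : ℝ) : EReal) < indTopHausdorffDim n X ∧ d - n ≤ (q : ℝ) := by
    rcases lt_or_ge d n with hdn | hdn
    -- Here `nullBound` 0 = -1 matters: n - 1 < n ≤ dim_{t^nH} holds even when the dimension equals
    -- n.
    · refine ⟨0, by simp, lt_of_lt_of_le ?_ hX, by simpa using hdn.le⟩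
      rw [← EReal.coe_natCast, EReal.coe_lt_coe_iff]
      simp [nullBound]
    · obtain ⟨q, hdq, hqX⟩ := EReal.lt_iff_exists_rat_btwn.1 hd
      have hdq' : d < q := EReal.coe_lt_coe_iff.1 hdq
      have hpos : (0 : ℝ) < ((q - n : ℚ) : ℝ) := by
        push_cast
        linarith
      refine ⟨q - n, hpos.le, ?_, ?_⟩
      · rw [nullBound, if_neg hpos.ne']
        rwa [Rat.cast_sub, Rat.cast_natCast, sub_add_cancel]
      · push_cast
        linarith
  obtain ⟨c, r, hr, h⟩ := hg q hq hqX
  refine ⟨c, r, hr, fun y hy => le_trans ?_ (h y hy)⟩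
  rw [← EReal.coe_natCast, ← EReal.coe_sub]
  exact EReal.coe_le_coe_iff.2 hdq

end Fibers

/-! ### Passage to Euclidean targets and the main theorem. -/

theorem hausdorffDim_le_of_finite_diff {X : Type u} [MetricSpace X] {E G : Set X}
    (hG : G.Nonempty) (hE : (E \ G).Finite) : hausdorffDim E ≤ hausdorffDim G := by
  rcases E.eq_empty_or_nonempty with rfl | hne
  · rw [hausdorffDim, if_pos rfl]
    exact neg_one_le_hausdorffDim G
  rw [hausdorffDim_of_nonempty hne, hausdorffDim_of_nonempty hG,
    EReal.coe_ennreal_le_coe_ennreal_iff]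
  calc dimH E ≤ dimH (G ∪ E \ G) := dimH_mono (by simp)
    _ = dimH G := by rw [dimH_union, dimH_finite hE, max_eq_left zero_le]

/-- A continuous map into Euclidean space is the tuple of its coordinates. -/
def euclideanCoordinates (X : Type u) [TopologicalSpace X] [LocallyCompactSpace X] (n : ℕ) :
    C(X, EuclideanSpace ℝ (Fin n)) ≃ₜ (Fin n → C(X, ℝ)) where
  toFun f i := ⟨fun x => f x i, by fun_prop⟩
  invFun g := ⟨fun x => WithLp.toLp 2 fun i => g i x, by fun_prop⟩
  left_inv f := by ext; rfl
  right_inv g := by ext; rfl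
  continuous_toFun := continuous_pi fun i => ContinuousMap.continuous_of_continuous_uncurry _ <|
    (PiLp.continuous_apply 2 _ i).comp (continuous_fst.eval continuous_snd)
  continuous_invFun := ContinuousMap.continuous_of_continuous_uncurry _ <|
    (PiLp.continuous_toLp 2 _).comp <| continuous_pi fun i =>
      ((continuous_apply i).comp continuous_fst).eval continuous_snd

theorem preimage_singleton_eq_coordinates {X : Type u} [TopologicalSpace X] [LocallyCompactSpace X]
    {n : ℕ} (f : C(X, EuclideanSpace ℝ (Fin n))) (y : EuclideanSpace ℝ (Fin n)) :
    f ⁻¹' {y} = {x | ∀ i, euclideanCoordinates X n f i x = y i} := by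
  ext x
  exact ⟨fun h i => congrArg (· i) h, fun h => PiLp.ext h⟩

theorem theorem6p9 (n : ℕ) (hn : 0 < n) (K : Type u) [MetricSpace K] [CompactSpace K]
    (hK : (n : WithBot ℕ∞) ≤ smallInductiveDimension K) :
    ∃ G : Set K, IsGδ G ∧ hausdorffDim G = indTopHausdorffDim n K - (n : EReal) ∧
      ∀ᶠ f : C(K, EuclideanSpace ℝ (Fin n)) in residual C(K, EuclideanSpace ℝ (Fin n)),
        (∀ y : EuclideanSpace ℝ (Fin n), ((f ⁻¹' {y}) \ G).encard ≤ (n : ℕ∞)) ∧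
        (∀ y : EuclideanSpace ℝ (Fin n),
          hausdorffDim (f ⁻¹' {y}) ≤ indTopHausdorffDim n K - (n : EReal)) ∧
        (∀ d : ℝ, (d : EReal) < indTopHausdorffDim n K →
          ∃ (c : EuclideanSpace ℝ (Fin n)) (r : ℝ), 0 < r ∧
            ∀ y ∈ Metric.ball c r, (d : EReal) - (n : EReal) ≤ hausdorffDim (f ⁻¹' {y})) := by
  have hD : (n : EReal) ≤ indTopHausdorffDim n K := by
    by_contra! hlt
    exact absurd hK (not_le.2 (smallInductiveDimension_lt_iff.2
      (hasSmallInductiveDimensionLT_of_indTopHausdorffDim_lt n K hlt)))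
  have : Nonempty K := by
    by_contra hemp
    rw [not_nonempty_iff] at hemp
    rw [smallInductiveDimension_of_isEmpty] at hK
    exact absurd hK (by simp)
  obtain ⟨G, hGδ, hGne, hGle, hGfib⟩ := exists_isGδ_residual_encard_le hD
  have hlow := residual_le_hausdorffDim_fiber hD
  have hfin : ∀ (g : Fin n → C(K, ℝ)) (y : Fin n → ℝ),
      ({x | ∀ i, g i x = y i} \ G).encard ≤ n →
      hausdorffDim {x | ∀ i, g i x = y i} ≤ hausdorffDim G := fun g y h =>
    hausdorffDim_le_of_finite_diff hGne (finite_of_encard_le_coe h)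
  have hGeq : hausdorffDim G = indTopHausdorffDim n K - (n : EReal) := by
    refine le_antisymm hGle ?_
    -- For each d below dim_{t^nH} K, this single map has a fibre of dimension at least d - n and at
    -- most that of G.
    obtain ⟨g, hg₁, hg₂⟩ := (dense_of_mem_residual (hGfib.and hlow)).nonempty
    have hsub : ∀ a : EReal, a - (n : EReal) ≤ hausdorffDim G ↔ a ≤ hausdorffDim G + (n : EReal) :=
      fun a => EReal.sub_le_iff_le_add (Or.inl (EReal.coe_ne_bot (n : ℝ)))
        (Or.inl (EReal.coe_ne_top (n : ℝ)))
    rw [hsub]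
    refine EReal.ge_of_forall_gt_iff_ge.1 fun d hd => (hsub d).1 ?_
    obtain ⟨c, r, hr, h⟩ := hg₂ d hd
    exact (h c fun i => by simpa using hr).trans (hfin g c (hg₁ c))
  refine ⟨G, hGδ, hGeq, ?_⟩
  have htend := tendsto_residual_of_isOpenMap (euclideanCoordinates K n).continuous
    (euclideanCoordinates K n).isOpenMap
  filter_upwards [htend.eventually (hGfib.and hlow)] with f ⟨hf₁, hf₂⟩
  simp only [preimage_singleton_eq_coordinates]
  refine ⟨fun y => hf₁ _, fun y => hGeq ▸ hfin _ _ (hf₁ _), fun d hd => ?_⟩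
  obtain ⟨c, r, hr, h⟩ := hf₂ d hd
  -- The Euclidean ball of radius r lies in the cube of half-side r.
  refine ⟨WithLp.toLp 2 c, r, hr, fun y hy => h _ fun i => ?_⟩
  rw [mem_ball, dist_eq_norm] at hy
  exact (PiLp.norm_apply_le (y - WithLp.toLp 2 c) i).trans_lt hy
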